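/- Let $G=(V,E)$ be a finite simple directed graph on $n$ vertices, where simple means that $G$ has no loops and at most one edge between any two vertices (so $uv$ and $vu$ are never both edges). Assume that every vertex of $G$ has in-degree at least one and that $G$ is strongly connected, i.e. for any two distinct vertices $u,v$ there is a directed path from $u$ to $v$. Let $\tau(v)=\lceil(\deg^{in}(v)+1)/2\rceil$ for every $v\in V$ (the strict majority threshold). Then the smallest size of a dynamic monopoly for $(G,\tau)$ is at most $\lfloor n/2\rfloor$; that is, there is a set $M\subseteq V$ with $|M|\le\lfloor n/2\rfloor$ such that $V$ can be partitioned into (possibly empty) sets $D_0,D_1,\dots,D_t$ with $D_0=M$ and, for every $i\ge 1$ and every $v\in D_i$, the number of edges from $D_0\cup\dots\cup D_{i-1}$ to $v$ is at least $\tau(v)$. -/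

import Mathlib

/-- A directed graph is simple if it has no loop and at most one edge between any two vertices
(in particular no directed cycle of length two). -/
def Digraph.IsSimple {V : Type*} (G : Digraph V) : Prop :=
  (∀ v : V, ¬ G.Adj v v) ∧ ∀ u v : V, G.Adj u v → ¬ G.Adj v u

/-- For any two distinct vertices `u`, `v` there is a directed path from `u` to `v`. -/
def Digraph.IsStronglyConnected {V : Type*} (G : Digraph V) : Prop :=
  ∀ u v : V, u ≠ v → Relation.TransGen G.Adj u v

open Classical in
/-- The set of in-neighbours of `v`. -/
noncomputable def Digraph.inNeighbors {V : Type*} [Fintype V] (G : Digraph V) (v : V) :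
    Finset V :=
  Finset.univ.filter fun u => G.Adj u v

/-- The in-degree of `v`. -/
noncomputable def Digraph.inDeg {V : Type*} [Fintype V] (G : Digraph V) (v : V) : ℕ :=
  (G.inNeighbors v).card

open Classical in
/-- `M` is a dynamic monopoly for `(G, τ)`: the vertex set is partitioned into
`D 0, …, D t` with `D 0 = M`, and every vertex `v` of `D i`, `i ≥ 1`, receives at least `τ v` edges
from `D 0 ∪ … ∪ D (i - 1)`. -/
def Digraph.IsDynamicMonopoly {V : Type*} [Fintype V] (G : Digraph V) (τ : V → ℕ)
    (M : Finset V) : Prop :=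
  ∃ (t : ℕ) (D : Fin (t + 1) → Finset V),
    (∀ i j, i ≠ j → Disjoint (D i) (D j)) ∧
    (∀ v : V, ∃ i, v ∈ D i) ∧
    D 0 = M ∧
    ∀ i, 0 < i → ∀ v ∈ D i,
      τ v ≤ ((G.inNeighbors v).filter fun u => ∃ j, j < i ∧ u ∈ D j).card

/-- The strict majority threshold `τ(v) = ⌈(deg⁻(v) + 1) / 2⌉`. -/
noncomputable def Digraph.strictMajority {V : Type*} [Fintype V] (G : Digraph V) (v : V) : ℕ :=
  ⌈((G.inDeg v : ℚ) + 1) / 2⌉₊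

/-! Put `f v = ⌈deg⁻ v / 2⌉`; the threshold plus `f v` is `deg⁻ v + 1`. Hence the complement of a
degenerate set is a dynamic monopoly, and it suffices to split `V` into two degenerate sets: the
smaller one is the monopoly.

Take a partial 2-colouring with degenerate classes and fewest uncoloured vertices (holes). A hole
has exactly `f` in-neighbours of each colour, so it can be moved back along any incoming edge
(`of_moveHole`). Strong connectivity brings it onto a chordless cycle, and rotating it there shows
that the rest of the cycle is monochromatic. Swapping colours on a suitable set off the cycle then
leaves the hole fewer than `f` in-neighbours of one colour, so it could be coloured
(`false_of_monochromatic`). -/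

namespace Digraph

section Degenerate

open Classical Finset

variable {V : Type*} [Fintype V] {G : Digraph V} {f : V → ℕ}

/-! ### Degenerate sets and activation orders -/

/-- Every nonempty subset `T` of `S` has a vertex `v` with fewer than `f v` in-neighbours in `T`. -/
def IsDegenerate (G : Digraph V) (f : V → ℕ) (S : Finset V) : Prop :=
  ∀ T ⊆ S, (∀ v ∈ T, f v ≤ #{u ∈ G.inNeighbors v | u ∈ T}) → T = ∅

theorem mem_inNeighbors {u v : V} : u ∈ G.inNeighbors v ↔ G.Adj u v := by
  simp [inNeighbors]

theorem IsDegenerate.mono {S T : Finset V} (hS : G.IsDegenerate f S) (h : T ⊆ S) :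
    G.IsDegenerate f T :=
  fun U hU => hS U (hU.trans h)

theorem IsDegenerate.insert_of_card_lt {S : Finset V} {r : V} (hS : G.IsDegenerate f S)
    (hr : #{u ∈ G.inNeighbors r | u ∈ insert r S} < f r) : G.IsDegenerate f (insert r S) := by
  intro T hT h
  by_cases hrT : r ∈ T
  · have h1 := h r hrT
    have h2 : #{u ∈ G.inNeighbors r | u ∈ T} ≤ #{u ∈ G.inNeighbors r | u ∈ insert r S} :=
      card_le_card (monotone_filter_right _ fun u _ hu => hT hu)
    omega
  · exact hS T ((subset_insert_iff_of_notMem hrT).1 hT) h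

/-- The activation times of the vertices when the complement of a degenerate set is active at
time `0`. -/
theorem IsDegenerate.exists_rank {S : Finset V} (hS : G.IsDegenerate f S) :
    ∃ g : V → ℕ, (∀ v, g v = 0 ↔ v ∉ S) ∧
      ∀ v ∈ S, G.inDeg v < #{u ∈ G.inNeighbors v | g u < g v} + f v := by
  induction hn : #S generalizing S with
  | zero =>
    obtain rfl := card_eq_zero.1 hn
    exact ⟨fun _ => 0, by simp, by simp⟩
  | succ n ih =>
    have hne : S ≠ ∅ := by rintro rfl; simp at hn
    have : ¬ ∀ v ∈ S, f v ≤ #{u ∈ G.inNeighbors v | u ∈ S} := fun h =>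
      hne (hS S subset_rfl h)
    push Not at this
    obtain ⟨v, hv, hlt⟩ := this
    obtain ⟨g, hg0, hg⟩ := ih (hS.mono (erase_subset v S)) (by rw [card_erase_of_mem hv]; omega)
    -- `v` is activated first: `g v = 0` gives it rank 1, and the rest of `S` moves up to ranks at
    -- least 2.
    refine ⟨fun u => if u ∈ S then g u + 1 else 0, fun u => by by_cases h : u ∈ S <;> simp [h], ?_⟩
    intro w hw
    by_cases hwv : w = v
    · subst hwv
      have hgw : g w = 0 := (hg0 w).2 (by simp)
      have h1 : #{u ∈ G.inNeighbors w | u ∉ S} ≤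
          #{u ∈ G.inNeighbors w | (if u ∈ S then g u + 1 else 0) <
            (if w ∈ S then g w + 1 else 0)} :=
        card_le_card (monotone_filter_right _ fun u _ hu => by simp [hu, hw])
      have h2 := card_filter_add_card_filter_not (s := G.inNeighbors w) (fun u => u ∈ S)
      unfold inDeg
      simp only at h1 h2 ⊢
      omega
    · have hgw : g w ≠ 0 := fun h => (hg0 w).1 h (mem_erase.2 ⟨hwv, hw⟩)
      have h1 : #{u ∈ G.inNeighbors w | g u < g w} ≤
          #{u ∈ G.inNeighbors w | (if u ∈ S then g u + 1 else 0) <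
            (if w ∈ S then g w + 1 else 0)} :=
        card_le_card (monotone_filter_right _ fun u _ hu => by
          rw [if_pos hw]; split_ifs <;> omega)
      have h2 := hg w (mem_erase.2 ⟨hwv, hw⟩)
      simp only at h1 ⊢
      omega

theorem IsDegenerate.isDynamicMonopoly_compl {τ : V → ℕ} {S : Finset V}
    (hS : G.IsDegenerate f S) (hτ : ∀ v, τ v + f v ≤ G.inDeg v + 1) :
    G.IsDynamicMonopoly τ Sᶜ := by
  obtain ⟨g, hg0, hg⟩ := hS.exists_rank
  refine ⟨univ.sup g, fun i => {v | g v = i}, ?_, ?_, ?_, ?_⟩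
  · intro i j hij
    rw [disjoint_left]
    intro v hi hj
    simp only [mem_filter, mem_univ, true_and] at hi hj
    exact hij (Fin.ext (hi.symm.trans hj))
  · intro v
    exact ⟨⟨g v, Nat.lt_succ_of_le (le_sup (mem_univ v))⟩, by simp⟩
  · ext v
    simp [hg0]
  · intro i hi v hv
    have hvi : g v = i := by simpa using hv
    beta_reduce
    have hvS : v ∈ S := by
      by_contra h
      have := (hg0 v).2 h
      have : (0 : ℕ) < i := hi
      omega
    have h1 := hg v hvS
    have h2 := hτ v
    have h3 : #{u ∈ G.inNeighbors v | g u < g v} ≤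
        #{u ∈ G.inNeighbors v | ∃ j, j < i ∧ u ∈ ({v | g v = (j : Fin (univ.sup g + 1))} : Finset V)} :=
      card_le_card (monotone_filter_right _ fun u _ hu =>
        ⟨⟨g u, Nat.lt_succ_of_le (le_sup (mem_univ u))⟩, by
          rw [Fin.lt_def, ← hvi]; exact hu, by simp⟩)
    refine le_trans ?_ (h3.trans (le_of_eq (by congr)))
    omega

/-! ### Optimal partial colourings -/

/-- The vertices of colour `b` in a partial colouring `X`. -/
def colorClass (X : V → Option Bool) (b : Bool) : Finset V := {v | X v = some b}

theorem mem_colorClass {X : V → Option Bool} {b : Bool} {v : V} :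
    v ∈ colorClass X b ↔ X v = some b := by
  simp [colorClass]

/-- A partial colouring with two colours whose colour classes are degenerate. -/
def IsValidColoring (G : Digraph V) (f : V → ℕ) (X : V → Option Bool) : Prop :=
  ∀ b, G.IsDegenerate f (colorClass X b)

/-- A valid partial colouring with the least number of uncoloured vertices. -/
def IsOptimalColoring (G : Digraph V) (f : V → ℕ) (X : V → Option Bool) : Prop :=
  G.IsValidColoring f X ∧ ∀ Y, G.IsValidColoring f Y → #{v | X v = none} ≤ #{v | Y v = none}

theorem exists_isOptimalColoring (G : Digraph V) (f : V → ℕ) :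
    ∃ X, G.IsOptimalColoring f X := by
  have h0 : G.IsValidColoring f fun _ => none := fun b T hT _ =>
    eq_empty_of_forall_notMem fun v hv => by simpa [mem_colorClass] using hT hv
  obtain ⟨X, hX, hmin⟩ := Set.exists_min_image {X | G.IsValidColoring f X}
    (fun X => #{v | X v = none}) (Set.toFinite _) ⟨_, h0⟩
  exact ⟨X, hX, hmin⟩

theorem IsOptimalColoring.of_card_eq {X Y : V → Option Bool} (hX : G.IsOptimalColoring f X)
    (hY : G.IsValidColoring f Y) (h : #{v | Y v = none} = #{v | X v = none}) :
    G.IsOptimalColoring f Y :=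
  ⟨hY, fun Z hZ => h.trans_le (hX.2 Z hZ)⟩

theorem IsValidColoring.update_some {X : V → Option Bool} (hX : G.IsValidColoring f X) {r : V}
    {b : Bool} (hr : X r = none) (hloop : ¬ G.Adj r r)
    (hlt : #{u ∈ G.inNeighbors r | X u = some b} < f r) :
    G.IsValidColoring f (Function.update X r (some b)) := by
  intro b'
  by_cases hb : b' = b
  · subst hb
    have h1 : colorClass (Function.update X r (some b')) b' = insert r (colorClass X b') := by
      ext v
      by_cases hv : v = r <;> simp [mem_colorClass, hv]
    rw [h1]
    refine (hX b').insert_of_card_lt (lt_of_le_of_lt (card_le_card ?_) hlt)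
    intro u hu
    rw [mem_filter, mem_insert, mem_colorClass] at hu
    refine mem_filter.2 ⟨hu.1, hu.2.resolve_left ?_⟩
    rintro rfl
    exact hloop (mem_inNeighbors.1 hu.1)
  · refine (hX b').mono fun v hv => ?_
    rw [mem_colorClass] at hv ⊢
    by_cases hvr : v = r
    · subst hvr
      simp [Ne.symm hb] at hv
    · rwa [Function.update_of_ne hvr] at hv

theorem IsOptimalColoring.le_card {X : V → Option Bool} (hX : G.IsOptimalColoring f X) {r : V}
    (hr : X r = none) (hloop : ¬ G.Adj r r) (b : Bool) :
    f r ≤ #{u ∈ G.inNeighbors r | X u = some b} := by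
  by_contra! hlt
  have h := hX.2 _ (hX.1.update_some hr hloop hlt)
  have h2 : #{v | Function.update X r (some b) v = none} < #{v | X v = none} := by
    refine card_lt_card ((ssubset_iff_of_subset ?_).2 ⟨r, by simpa using hr, by simp⟩)
    intro v hv
    by_cases hvr : v = r
    · simpa [hvr] using hr
    · simpa [Function.update_of_ne hvr] using hv
  omega

/-- By optimality each colour occurs at least `f r` times, and `inDeg r ≤ 2 * f r` leaves no slack.
-/
theorem IsOptimalColoring.card_eq {X : V → Option Bool} (hX : G.IsOptimalColoring f X) {r : V}
    (hr : X r = none) (hloop : ¬ G.Adj r r) (hf : G.inDeg r ≤ 2 * f r) (b : Bool) :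
    #{u ∈ G.inNeighbors r | X u = some b} = f r ∧ ∀ u, G.Adj u r → X u ≠ none := by
  have h1 := hX.le_card hr hloop b
  have h2 := hX.le_card hr hloop (!b)
  have h3 : #{u ∈ G.inNeighbors r | X u = some b} + #{u ∈ G.inNeighbors r | X u = some (!b)} +
      #{u ∈ G.inNeighbors r | X u = none} = G.inDeg r := by
    rw [← card_union_of_disjoint, ← card_union_of_disjoint, inDeg]
    · congr 1
      ext u
      cases h : X u with
      | none => simp [h]
      | some a => cases a <;> cases b <;> simp [h]
    · rw [disjoint_left]
      intro u hu hu'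
      simp only [mem_union, mem_filter] at hu hu'
      rcases hu with hu | hu <;> simp [hu.2] at hu'
    · rw [disjoint_left]
      intro u hu hu'
      simp only [mem_filter] at hu hu'
      simp [hu.2] at hu'
  refine ⟨by omega, fun u hu hn => ?_⟩
  have : 0 < #{u ∈ G.inNeighbors r | X u = none} :=
    card_pos.2 ⟨u, mem_filter.2 ⟨mem_inNeighbors.2 hu, hn⟩⟩
  omega

/-! ### Moving the hole and swapping colours -/

/-- Uncolour `u` and give its colour to `r`. -/
noncomputable def moveHole (X : V → Option Bool) (r u : V) : V → Option Bool :=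
  Function.update (Function.update X u none) r (X u)

/-- Uncolouring `u` brings its colour below `f r` among the in-neighbours of `r`, so `r` can take
it; the number of holes is unchanged. -/
theorem IsOptimalColoring.of_moveHole {X : V → Option Bool} (hX : G.IsOptimalColoring f X) {r u : V}
    (hr : X r = none) (hloop : ¬ G.Adj r r) (hf : G.inDeg r ≤ 2 * f r) (hu : G.Adj u r) :
    G.IsOptimalColoring f (moveHole X r u) := by
  obtain ⟨b, hb⟩ := Option.ne_none_iff_exists'.1 ((hX.card_eq hr hloop hf true).2 u hu)
  have hur : u ≠ r := by rintro rfl; exact hloop hu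
  refine hX.of_card_eq ?_ ?_
  · have hv : G.IsValidColoring f (Function.update X u none) := fun b' =>
      (hX.1 b').mono fun v hv => by
        rw [mem_colorClass] at hv ⊢
        by_cases hvu : v = u
        · simp [hvu] at hv
        · rwa [Function.update_of_ne hvu] at hv
    rw [moveHole, hb]
    refine hv.update_some (by rwa [Function.update_of_ne hur.symm]) hloop ?_
    rw [← (hX.card_eq hr hloop hf b).1]
    refine card_lt_card ((ssubset_iff_of_subset ?_).2
      ⟨u, mem_filter.2 ⟨mem_inNeighbors.2 hu, hb⟩, by simp⟩)
    intro v hv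
    by_cases hvu : v = u
    · simp [hvu] at hv
    · simpa [Function.update_of_ne hvu] using hv
  · have h1 : ({v | moveHole X r u v = none} : Finset V) =
        insert u (({v | X v = none} : Finset V).erase r) := by
      ext v
      simp only [mem_insert, mem_erase, mem_filter, mem_univ, true_and]
      by_cases hvr : v = r
      · subst hvr
        simp [moveHole, hb, hur.symm]
      · by_cases hvu : v = u
        · subst hvu
          simp [moveHole, hur]
        · simp [moveHole, hvr, hvu]
    rw [h1, card_insert_of_notMem (by simp [hb]), card_erase_add_one (by simpa using hr)]

/-- The uncoloured vertex can be moved backwards along a path avoiding `C`. -/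
theorem IsOptimalColoring.exists_of_reflTransGen {X : V → Option Bool}
    (hX : G.IsOptimalColoring f X) (hloop : ∀ v, ¬ G.Adj v v) (hf : ∀ v, G.inDeg v ≤ 2 * f v)
    {C : Set V} {r w : V} (hr : X r = none) (hrC : r ∉ C)
    (h : Relation.ReflTransGen (fun a b => G.Adj b a ∧ b ∉ C) r w) :
    w ∉ C ∧ ∃ Y, G.IsOptimalColoring f Y ∧ Y w = none ∧ ∀ v ∈ C, Y v = X v := by
  induction h with
  | refl => exact ⟨hrC, X, hX, hr, fun _ _ => rfl⟩
  | @tail a b _ hab ih =>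
    obtain ⟨haC, Y, hY, hYa, hYC⟩ := ih
    refine ⟨hab.2, moveHole Y a b, hY.of_moveHole hYa (hloop a) (hf a) hab.1, ?_, ?_⟩
    · have : b ≠ a := by rintro rfl; exact hloop _ hab.1
      simp [moveHole, this]
    · intro v hv
      have h1 : v ≠ a := by rintro rfl; exact haC hv
      have h2 : v ≠ b := by rintro rfl; exact hab.2 hv
      simp [moveHole, h1, h2, hYC v hv]

theorem IsStronglyConnected.exists_optimal (hG : G.IsStronglyConnected)
    (hloop : ∀ v, ¬ G.Adj v v) (hf : ∀ v, G.inDeg v ≤ 2 * f v) {X : V → Option Bool}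
    (hX : G.IsOptimalColoring f X) {r : V} (hr : X r = none) (w : V) :
    ∃ Y, G.IsOptimalColoring f Y ∧ Y w = none := by
  by_cases hwr : w = r
  · exact ⟨X, hX, hwr ▸ hr⟩
  · have h := (Relation.transGen_swap.2 (hG w r hwr)).to_reflTransGen
    obtain ⟨-, Y, hY, hYw, -⟩ := hX.exists_of_reflTransGen hloop hf (C := ∅) hr (by simp)
      (Relation.ReflTransGen.mono (fun a b hab => ⟨hab, by simp⟩) _ _ h)
    exact ⟨Y, hY, hYw⟩

/-- Exchange the two colours on `S`. -/
noncomputable def swapOn (X : V → Option Bool) (S : Set V) (v : V) : Option Bool :=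
  if v ∈ S then (X v).map not else X v

/-- In a set `T` violating degeneracy, vertices of `T ∩ S` have all their in-neighbours from `T` in
`S`. So `T ∩ S`, lying in one old class, is empty, and then `T` lies in the other. -/
theorem IsOptimalColoring.of_swapOn {X : V → Option Bool} (hX : G.IsOptimalColoring f X) {S : Set V}
    (hS : ∀ w ∈ S, ∀ v, G.Adj v w → v ∈ S ∨ X v = none) :
    G.IsOptimalColoring f (swapOn X S) := by
  refine hX.of_card_eq ?_ ?_
  · intro b T hT h
    have hTS : (T.filter (· ∈ S)) = ∅ := by
      refine hX.1 (!b) _ (fun v hv => ?_) fun v hv => ?_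
      · rw [mem_filter] at hv
        have := mem_colorClass.1 (hT hv.1)
        rw [swapOn, if_pos hv.2] at this
        rw [mem_colorClass]
        cases hx : X v with
        | none => simp [hx] at this
        | some c => simp [hx] at this; simp [← this]
      · rw [mem_filter] at hv
        refine (h v hv.1).trans (card_le_card fun u hu => ?_)
        rw [mem_filter] at hu
        refine mem_filter.2 ⟨hu.1, mem_filter.2 ⟨hu.2, ?_⟩⟩
        refine (hS v hv.2 u (mem_inNeighbors.1 hu.1)).resolve_right fun hn => ?_
        have := mem_colorClass.1 (hT hu.2)
        rw [swapOn, hn] at this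
        simp at this
    refine hX.1 b T (fun v hv => ?_) h
    have hvS : v ∉ S := fun hvS => by
      have : v ∈ T.filter (· ∈ S) := mem_filter.2 ⟨hv, hvS⟩
      simp [hTS] at this
    have := mem_colorClass.1 (hT hv)
    rw [swapOn, if_neg hvS] at this
    exact mem_colorClass.2 this
  · congr 1
    ext v
    simp only [mem_filter, mem_univ, true_and]
    by_cases hv : v ∈ S <;> simp [swapOn, hv]

/-- There is no set `C` with the stated properties in which the coloured vertices are
monochromatic whenever an optimal colouring misses a vertex of `C`. -/
theorem IsOptimalColoring.false_of_monochromatic {X : V → Option Bool}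
    (hX : G.IsOptimalColoring f X) (hloop : ∀ v, ¬ G.Adj v v) (hf : ∀ v, G.inDeg v ≤ 2 * f v)
    {C : Set V} {c p : V} (hc : c ∈ C) (hp : p ∈ C) (hpc : G.Adj p c)
    (hthree : ∀ v, v ≠ c → ∃ w ∈ C, w ≠ c ∧ w ≠ v)
    (hmono : ∀ Y, G.IsOptimalColoring f Y → ∀ r ∈ C, Y r = none →
      ∃ b, ∀ v ∈ C, v ≠ r → Y v = some b)
    (hXc : X c = none) : False := by
  obtain ⟨a, ha⟩ := hmono X hX c hc hXc
  have hpne : p ≠ c := by rintro rfl; exact hloop _ hpc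
  set S : Set V := {w | ∃ y, G.Adj y c ∧ X y = some (!a) ∧
    Relation.ReflTransGen (fun a b => G.Adj b a ∧ b ∉ C) y w} with hSdef
  have hnotC : ∀ y, G.Adj y c → X y = some (!a) → y ∉ C := by
    intro y hyc hy hyC
    have := ha y hyC fun h => hloop c (h ▸ hyc)
    rw [this] at hy
    simp at hy
  have hSC : ∀ w ∈ S, w ∉ C := by
    rintro w ⟨y, hyc, hy, hyw⟩
    cases hyw with
    | refl => exact hnotC w hyc hy
    | tail _ h => exact h.2
  have hcl : ∀ w ∈ S, ∀ v, G.Adj v w → v ∈ S ∨ X v = none := by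
    rintro w ⟨y, hyc, hy, hyw⟩ v hvw
    by_cases hvC : v ∈ C
    · by_cases hvc : v = c
      · exact Or.inr (hvc ▸ hXc)
      -- An edge from `v ∈ C` into `S` would let the hole travel from `c` through `y` and `w` to
      -- `v`, leaving `c` coloured `!a` and a third vertex `u` of `C` coloured `a`.
      exfalso
      have hyC := hnotC y hyc hy
      have hyne : y ≠ c := by rintro rfl; exact hyC hc
      obtain ⟨hwC, Y, hY, hYw, hYC⟩ := (hX.of_moveHole hXc (hloop c) (hf c) hyc).exists_of_reflTransGen
        hloop hf (C := C) (by simp [moveHole, hyne]) hyC hyw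
      have hvwne : v ≠ w := by rintro rfl; exact hwC hvC
      obtain ⟨b, hb⟩ := hmono _ (hY.of_moveHole hYw (hloop w) (hf w) hvw) v hvC
        (by simp [moveHole, hvwne])
      obtain ⟨u, huC, huc, huv⟩ := hthree v hvc
      have hval : ∀ x ∈ C, x ≠ v → moveHole Y w v x = moveHole X c y x := by
        intro x hx hxv
        have : x ≠ w := by rintro rfl; exact hwC hx
        rw [← hYC x hx]
        simp [moveHole, this, hxv]
      have h1 := hb c hc (Ne.symm hvc)
      have h2 := hb u huC huv
      rw [hval _ hc (Ne.symm hvc)] at h1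
      rw [hval _ huC huv] at h2
      have huy : u ≠ y := by rintro rfl; exact hyC huC
      simp [moveHole, hy] at h1
      simp [moveHole, huc, huy, ha u huC huc] at h2
      subst h2
      cases a <;> simp at h1
    · exact Or.inl ⟨y, hyc, hy, hyw.tail ⟨hvw, hvC⟩⟩
  -- In-neighbours of `c` coloured `!a` after the swap were all coloured `a` before, and `p` stays
  -- `a`: there are fewer than `f c` of them.
  have hlow := (hX.of_swapOn hcl).le_card (r := c)
    (by rw [swapOn, if_neg fun h => hSC c h hc, hXc]) (hloop c) (!a)
  rw [← (hX.card_eq hXc (hloop c) (hf c) a).1] at hlow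
  refine absurd hlow (not_le_of_gt (card_lt_card ((ssubset_iff_of_subset ?_).2
    ⟨p, mem_filter.2 ⟨mem_inNeighbors.2 hpc, ha p hp hpne⟩, ?_⟩)))
  · intro u hu
    rw [mem_filter] at hu ⊢
    refine ⟨hu.1, ?_⟩
    have huc := mem_inNeighbors.1 hu.1
    have hu2 := hu.2
    by_cases huS : u ∈ S
    · rw [swapOn, if_pos huS] at hu2
      cases hx : X u with
      | none => simp [hx] at hu2
      | some e =>
        rw [hx] at hu2
        cases e <;> cases a <;> first | rfl | simp at hu2
    · rw [swapOn, if_neg huS] at hu2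
      exact absurd ⟨u, huc, hu2, Relation.ReflTransGen.refl⟩ huS
  · rw [mem_filter, swapOn, if_neg fun h => hSC p h hp, ha p hp hpne]
    simp

/-! ### Chordless cycles from shortest closed walks -/

/-- A closed walk of length `k`, traversed backwards. -/
def IsClosedWalk (G : Digraph V) (k : ℕ) (c : ℕ → V) : Prop :=
  0 < k ∧ c k = c 0 ∧ ∀ i < k, G.Adj (c (i + 1)) (c i)

theorem exists_isClosedWalk [Nonempty V] (hpos : ∀ v, 1 ≤ G.inDeg v) :
    ∃ k c, G.IsClosedWalk k c := by
  have h : ∀ v, ∃ u, G.Adj u v := fun v => by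
    obtain ⟨u, hu⟩ := card_pos.1 (hpos v)
    exact ⟨u, mem_inNeighbors.1 hu⟩
  choose p hp using h
  obtain ⟨x⟩ := ‹Nonempty V›
  obtain ⟨m, n, hmn, heq⟩ := Finite.exists_ne_map_eq_of_infinite fun i : ℕ => p^[i] x
  wlog hlt : m < n generalizing m n
  · exact this n m hmn.symm heq.symm (by omega)
  refine ⟨n - m, fun i => p^[m + i] x, by omega, ?_, fun i _ => ?_⟩
  · simp only [Nat.add_sub_cancel' hlt.le, add_zero]
    exact heq.symm
  · simp only [← add_assoc, Function.iterate_succ_apply']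
    exact hp _

theorem exists_chordless_cycle [Nonempty V] (hpos : ∀ v, 1 ≤ G.inDeg v) (hG : G.IsSimple) :
    ∃ (k : ℕ) (c : ℕ → V), 3 ≤ k ∧ (∀ i, c (i + k) = c i) ∧ (∀ i, G.Adj (c (i + 1)) (c i)) ∧
      (∀ i j, i < j → j ≤ i + k → G.Adj (c j) (c i) → j = i + 1) ∧
      ∀ i j, i < j → j < i + k → c i ≠ c j := by
  have hex := exists_isClosedWalk hpos
  obtain ⟨c, hk, hck, hc⟩ := Nat.find_spec hex
  have hmin := fun m => Nat.find_min' hex (m := m)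
  set k := Nat.find hex
  have hper : ∀ i, c ((i + k) % k) = c (i % k) := fun i => by rw [Nat.add_mod_right]
  have hadj : ∀ i, G.Adj (c ((i + 1) % k)) (c (i % k)) := by
    intro i
    have hlt := Nat.mod_lt i hk
    rcases Nat.lt_or_ge (i % k + 1) k with h | h
    · rw [Nat.add_mod, Nat.mod_eq_of_lt (a := 1) (by omega), Nat.mod_eq_of_lt h]
      exact hc _ hlt
    · have h1 : (i + 1) % k = 0 := by
        rw [← Nat.mod_add_mod, show i % k + 1 = k by omega, Nat.mod_self]
      have h2 := hc _ hlt
      rwa [show i % k + 1 = k by omega, hck, ← h1] at h2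
  generalize hc' : (fun i => c (i % k)) = e
  have hper' : ∀ i, e (i + k) = e i := by subst hc'; exact hper
  have hadj' : ∀ i, G.Adj (e (i + 1)) (e i) := by subst hc'; exact hadj
  have hch : ∀ i j, i < j → j ≤ i + k → G.Adj (e j) (e i) → j = i + 1 := by
    intro i j hij hj h
    -- The edge `e j → e i` closes up the walk `e i, e j, e (j + 1), …, e (i + k) = e i`.
    have := hmin (i + k - j + 1) ⟨fun m => if m = 0 then e i else e (j + m - 1), by omega, ?_, ?_⟩
    · omega
    · simp only [Nat.add_eq_zero_iff, one_ne_zero, and_false, if_false, if_true]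
      rw [show j + (i + k - j + 1) - 1 = i + k by omega, hper']
    · intro m hm
      by_cases hm0 : m = 0
      · subst hm0; simpa using h
      · simp only [hm0, if_false, Nat.add_eq_zero_iff, one_ne_zero, and_false]
        rw [show j + (m + 1) - 1 = j + m - 1 + 1 by omega]
        exact hadj' _
  have h3 : 3 ≤ k := by
    by_contra! hlt
    have h0 := hadj' 0
    have h1 := hadj' 1
    rcases (by omega : k = 1 ∨ k = 2) with h | h
    · have := hper' 0
      rw [h] at this
      rw [this] at h0
      exact hG.1 _ h0
    · have := hper' 0
      rw [h] at this
      simp only [zero_add, Nat.reduceAdd] at this h1 h0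
      rw [this] at h1
      exact hG.2 _ _ h0 h1
  refine ⟨k, e, h3, hper', hadj', hch, fun i j hij hj heq => ?_⟩
  -- A repetition would make `e (i + 1 + k) → e j` an edge, forcing `j = i + k`.
  have h1 := hadj' i
  rw [heq, ← hper' (i + 1)] at h1
  have := hch j (i + 1 + k) (by omega) (by omega) h1
  omega

/-! ### Rotating the hole around a chordless cycle -/

section Cycle

variable {k : ℕ} {c : ℕ → V}

theorem IsOptimalColoring.exists_shift {X : V → Option Bool} (hX : G.IsOptimalColoring f X)
    (hloop : ∀ v, ¬ G.Adj v v) (hf : ∀ v, G.inDeg v ≤ 2 * f v)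
    (hadj : ∀ i, G.Adj (c (i + 1)) (c i)) (hinj : ∀ i j, i < j → j < i + k → c i ≠ c j)
    {i : ℕ} (hi : X (c i) = none) (m : ℕ) (hm : m < k) :
    ∃ Y, G.IsOptimalColoring f Y ∧ Y (c (i + m)) = none ∧
      (∀ s < m, Y (c (i + s)) = X (c (i + s + 1))) ∧
      (∀ s, m < s → s < k → Y (c (i + s)) = X (c (i + s))) ∧
      ∀ v ∉ Set.range c, Y v = X v := by
  induction m with
  | zero => exact ⟨X, hX, hi, by simp, fun _ _ _ => rfl, fun _ _ => rfl⟩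
  | succ m ih =>
    obtain ⟨Y, hY, hY0, hY1, hY2, hY3⟩ := ih (by omega)
    refine ⟨moveHole Y (c (i + m)) (c (i + m + 1)),
      hY.of_moveHole hY0 (hloop _) (hf _) (hadj _), ?_, ?_, ?_, ?_⟩
    · have := hinj (i + m) (i + m + 1) (by omega) (by omega)
      simp [moveHole, ← add_assoc, this.symm]
    · intro s hs
      rcases (by omega : s = m ∨ s < m) with rfl | hs
      · have := hY2 (s + 1) (by omega) (by omega)
        rw [← add_assoc] at this
        simp [moveHole, this]
      · have h1 := hinj (i + s) (i + m) (by omega) (by omega)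
        have h2 := hinj (i + s) (i + m + 1) (by omega) (by omega)
        simp [moveHole, h1, h2, hY1 s hs]
    · intro s hs hsk
      have h1 := hinj (i + m) (i + s) (by omega) (by omega)
      have h2 := hinj (i + m + 1) (i + s) (by omega) (by omega)
      simp [moveHole, h1.symm, h2.symm, hY2 s (by omega) hsk]
    · intro v hv
      have h1 : v ≠ c (i + m) := by rintro rfl; exact hv ⟨_, rfl⟩
      have h2 : v ≠ c (i + m + 1) := by rintro rfl; exact hv ⟨_, rfl⟩
      simp [moveHole, h1, h2, hY3 v hv]

theorem exists_index_of_periodic {α : Type*} {k : ℕ} {c : ℕ → α} (hper : ∀ i, c (i + k) = c i) (hk : 0 < k) (i j : ℕ) :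
    ∃ s < k, c (i + s) = c j := by
  have hmul : ∀ a b, c (a + k * b) = c a := by
    intro a b
    induction b with
    | zero => simp
    | succ b ih => rw [mul_add, mul_one, ← add_assoc, hper, ih]
  -- The multiple `k * i` keeps the truncated subtraction exact.
  refine ⟨(j + k * i - i) % k, Nat.mod_lt _ hk, ?_⟩
  rw [← hmul (i + _) ((j + k * i - i) / k), add_assoc, Nat.mod_add_div, ← hmul j i]
  have : i ≤ k * i := Nat.le_mul_of_pos_left i hk
  congr 1
  omega

/-- After a full turn the hole is back at `c i` and `c (i + 1)` carries the old colour of `c (i +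
2)`. No other in-neighbour of `c i` lies on the cycle, so the counts at `c i` stay equal to `f (c
i)` only if these colours agree. -/
theorem IsOptimalColoring.eq_succ_of_cycle {X : V → Option Bool} (hX : G.IsOptimalColoring f X)
    (hloop : ∀ v, ¬ G.Adj v v) (hf : ∀ v, G.inDeg v ≤ 2 * f v) (hk : 3 ≤ k)
    (hper : ∀ i, c (i + k) = c i)
    (hadj : ∀ i, G.Adj (c (i + 1)) (c i))
    (hch : ∀ i j, i < j → j ≤ i + k → G.Adj (c j) (c i) → j = i + 1)
    (hinj : ∀ i j, i < j → j < i + k → c i ≠ c j)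
    {i : ℕ} (hi : X (c i) = none) : X (c (i + 1)) = X (c (i + 2)) := by
  obtain ⟨Y, hY, hY0, hY1, -, hY3⟩ :=
    hX.exists_shift hloop hf hadj hinj hi (k - 1) (by omega)
  have hback : G.Adj (c i) (c (i + (k - 1))) := by
    have := hadj (i + (k - 1))
    rwa [show i + (k - 1) + 1 = i + k by omega, hper] at this
  have hZ := hY.of_moveHole hY0 (hloop _) (hf _) hback
  have hne := hinj i (i + (k - 1)) (by omega) (by omega)
  have hZ0 : moveHole Y (c (i + (k - 1))) (c i) (c i) = none := by
    simp [moveHole, hne]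
  have hZ1 : moveHole Y (c (i + (k - 1))) (c i) (c (i + 1)) = X (c (i + 2)) := by
    have h1 := hinj (i + 1) (i + (k - 1)) (by omega) (by omega)
    have h2 := hinj i (i + 1) (by omega) (by omega)
    simp [moveHole, h1, h2.symm, hY1 1 (by omega), add_assoc]
  have hZ3 : ∀ v ∉ Set.range c, moveHole Y (c (i + (k - 1))) (c i) v = X v := by
    intro v hv
    have h1 : v ≠ c (i + (k - 1)) := by rintro rfl; exact hv ⟨_, rfl⟩
    have h2 : v ≠ c i := by rintro rfl; exact hv ⟨_, rfl⟩
    simp [moveHole, h1, h2, hY3 v hv]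
  obtain ⟨b, hb⟩ := Option.ne_none_iff_exists'.1
    ((hX.card_eq hi (hloop _) (hf _) true).2 _ (hadj i))
  by_contra hneq
  have hlow := hZ.le_card hZ0 (hloop _) b
  rw [← (hX.card_eq hi (hloop _) (hf _) b).1] at hlow
  refine absurd hlow (not_le_of_gt (card_lt_card ((ssubset_iff_of_subset ?_).2
    ⟨c (i + 1), mem_filter.2 ⟨mem_inNeighbors.2 (hadj i), hb⟩, ?_⟩)))
  · intro u hu
    rw [mem_filter] at hu ⊢
    refine ⟨hu.1, ?_⟩
    by_cases huc : u ∈ Set.range c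
    · obtain ⟨j, rfl⟩ := huc
      obtain ⟨s, hs, hsj⟩ := exists_index_of_periodic hper (by omega) (i + 1) j
      have hadj_j := mem_inNeighbors.1 hu.1
      rw [← hsj] at hadj_j
      have := hch i (i + 1 + s) (by omega) (by omega) hadj_j
      obtain rfl : s = 0 := by omega
      rw [← hsj]
      exact hb
    · rw [← hZ3 u huc]
      exact hu.2
  · rw [mem_filter, hZ1, ← hb]
    exact fun h => hneq h.2.symm

/-- Moving the hole `s` steps leaves the cycle vertices ahead untouched, so equality of the next two
colours propagates. -/
theorem IsOptimalColoring.monochromatic_of_cycle {X : V → Option Bool}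
    (hX : G.IsOptimalColoring f X)
    (hloop : ∀ v, ¬ G.Adj v v) (hf : ∀ v, G.inDeg v ≤ 2 * f v) (hk : 3 ≤ k)
    (hper : ∀ i, c (i + k) = c i)
    (hadj : ∀ i, G.Adj (c (i + 1)) (c i))
    (hch : ∀ i j, i < j → j ≤ i + k → G.Adj (c j) (c i) → j = i + 1)
    (hinj : ∀ i j, i < j → j < i + k → c i ≠ c j)
    {i : ℕ} (hi : X (c i) = none) :
    ∃ b, ∀ v ∈ Set.range c, v ≠ c i → X v = some b := by
  have hstep : ∀ s, s + 1 < k → X (c (i + (s + 1))) = X (c (i + 1)) := by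
    intro s hs
    induction s with
    | zero => simp
    | succ s ih =>
      rw [← ih (by omega)]
      obtain ⟨Y, hY, hY0, -, hY2, -⟩ := hX.exists_shift hloop hf hadj hinj hi s (by omega)
      have := hY.eq_succ_of_cycle hloop hf hk hper hadj hch hinj hY0
      rw [add_assoc, add_assoc, hY2 _ (by omega) (by omega), hY2 _ (by omega) (by omega)] at this
      exact this.symm
  obtain ⟨b, hb⟩ := Option.ne_none_iff_exists'.1
    ((hX.card_eq hi (hloop _) (hf _) true).2 _ (hadj i))
  refine ⟨b, ?_⟩
  rintro _ ⟨j, rfl⟩ hne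
  obtain ⟨s, hs, hsj⟩ := exists_index_of_periodic hper (by omega) i j
  rw [← hsj] at hne ⊢
  obtain _ | s := s
  · exact absurd rfl hne
  · rw [hstep s hs, hb]

end Cycle

/-! ### The degenerate partition and the majority threshold -/

/-- A strongly connected simple digraph can be partitioned into two degenerate sets. -/
theorem IsStronglyConnected.exists_degenerate_partition (hG : G.IsStronglyConnected)
    (hs : G.IsSimple) (hpos : ∀ v, 1 ≤ G.inDeg v) (hf : ∀ v, G.inDeg v ≤ 2 * f v) :
    ∃ S : Finset V, G.IsDegenerate f S ∧ G.IsDegenerate f Sᶜ := by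
  obtain ⟨X, hX⟩ := exists_isOptimalColoring G f
  by_cases hall : ∀ v, X v ≠ none
  · refine ⟨colorClass X true, hX.1 true, (hX.1 false).mono fun v hv => ?_⟩
    rw [mem_compl, mem_colorClass] at hv
    rw [mem_colorClass]
    obtain ⟨b, hb⟩ := Option.ne_none_iff_exists'.1 (hall v)
    cases b
    · exact hb
    · exact absurd hb hv
  push Not at hall
  obtain ⟨r, hr⟩ := hall
  exfalso
  have : Nonempty V := ⟨r⟩
  obtain ⟨k, c, hk, hper, hadj, hch, hinj⟩ := exists_chordless_cycle hpos hs
  obtain ⟨Y, hY, hY0⟩ := hG.exists_optimal hs.1 hf hX hr (c 0)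
  refine hY.false_of_monochromatic hs.1 hf (C := Set.range c) ⟨0, rfl⟩
    ⟨1, rfl⟩ (hadj 0) ?_ ?_ hY0
  · intro v _
    by_cases hv : v = c 1
    · exact ⟨c 2, ⟨2, rfl⟩, (hinj 0 2 (by omega) (by omega)).symm,
        hv ▸ (hinj 1 2 (by omega) (by omega)).symm⟩
    · exact ⟨c 1, ⟨1, rfl⟩, (hinj 0 1 (by omega) (by omega)).symm, Ne.symm hv⟩
  · rintro Z hZ _ ⟨i, rfl⟩ hZi
    exact hZ.monochromatic_of_cycle hs.1 hf hk hper hadj hch hinj hZi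

theorem strictMajority_eq (G : Digraph V) (v : V) : G.strictMajority v = G.inDeg v / 2 + 1 := by
  rw [strictMajority]
  have h := Nat.div_add_mod (G.inDeg v) 2
  have h' := Nat.mod_lt (G.inDeg v) two_pos
  generalize G.inDeg v / 2 = q at *
  generalize G.inDeg v % 2 = e at *
  rw [← h, Nat.ceil_eq_iff (by omega)]
  interval_cases e <;> push_cast <;> constructor <;> linarith

end Degenerate

end Digraph

theorem mainTheorem2 {V : Type*} [Fintype V] (G : Digraph V) (hsimple : G.IsSimple)
    (hpos : ∀ v : V, 1 ≤ G.inDeg v) (hconn : G.IsStronglyConnected) :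
    ∃ M : Finset V, G.IsDynamicMonopoly G.strictMajority M ∧ M.card ≤ Fintype.card V / 2 := by
  classical
  obtain ⟨S, hS, hS'⟩ := hconn.exists_degenerate_partition hsimple hpos
    (f := fun v => (G.inDeg v + 1) / 2) (fun v => by omega)
  have hτ : ∀ v, G.strictMajority v + (G.inDeg v + 1) / 2 ≤ G.inDeg v + 1 := fun v => by
    rw [G.strictMajority_eq]; omega
  have h1 := hS.isDynamicMonopoly_compl hτ
  have h2 := hS'.isDynamicMonopoly_compl hτ
  have hcard := Finset.card_add_card_compl S
  by_cases h : S.card ≤ Fintype.card V / 2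
  · exact ⟨S, by simpa using h2, h⟩
  · exact ⟨_, h1, by omega⟩
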